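/- Let $d\ge 1$. Let $K\subset\mathbb R^d$ be a $d$-dimensional convex polytope, i.e. the convex hull of a finite set whose affine hull is $\mathbb R^d$. Its faces are the intersections of $K$ with its supporting hyperplanes, and its vertices (set $V$) and facets (set $F$) are the faces of dimension $0$ and $d-1$. For $v\in V$ let $F_v=\{f\in F: v\in f\}$; $K$ is called simple if $|F_v|=d$ for every $v\in V$. Let $h_K$ be the diameter of $K$, and let $h_*$ be the minimal distance between a vertex $v\in V$ and the hyperplane containing a facet $f\in F$ with $v\notin f$. For $f\in F$ let $n_f$ be the unit outward normal of $f$ and $h_f(x)=(a-x)\cdot n_f$, with $a\in f$ arbitrary. For $v\in V$ let $M_v$ be the $d\times d$ matrix whose columns are the $n_f$, $f\in F_v$, and put $$w_v(x)=|\det M_v|\prod_{f\in F\setminus F_v}h_f(x),\qquad W=\sum_{u\in V}w_u,\qquad \varphi_v=\frac{w_v}{W}.$$ The functions $\varphi_v$, $v\in V$, are the Wachspress coordinates of $K$; they are regarded as rational functions on $\mathbb R^d$, so that their derivatives make sense at boundary points of $K$. **Theorem.** Let $d\ge 1$, let $\alpha\in\mathbb N_0^d$ be a multi-index, let $N_F,N_V\in\mathbb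 N$ and let $c>0$. There is a constant $C>0$, depending only on $d$, $\alpha$, $N_F$, $N_V$ and $c$, such that for every simple $d$-dimensional convex polytope $K\subset\mathbb R^d$ with $$|F|\le N_F,\qquad |V|\le N_V,\qquad h_*\ge c\,h_K,$$ the function $W$ is positive on $K$, and for every vertex $v\in V$ and every $x\in K$ the function $\varphi_v$ is $C^\infty$ at $x$ (that is, for every $m\in\mathbb N$ it is $C^m$ in a neighbourhood of $x$) and $$|D^\alpha\varphi_v(x)|\le C\,h_K^{-|\alpha|}.$$ -/

import Mathlib

open scoped ContDiff RealInnerProductSpace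

noncomputable section

namespace Wachspress

/-- The space `ℝ^d` with the Euclidean norm. -/
abbrev Space (d : ℕ) : Type := EuclideanSpace ℝ (Fin d)

variable {d : ℕ}

/-- The vertices of `K`: the points `v` for which `{v}` is a (zero-dimensional) face, that is, the
intersection of `K` with a supporting hyperplane. -/
def vertices (K : Set (Space d)) : Set (Space d) := {v | IsExposed ℝ K {v}}

/-- The facets of `K`: the nonempty faces whose affine hull has dimension `d - 1`. -/
def facets (K : Set (Space d)) : Set (Set (Space d)) :=
  {f | IsExposed ℝ K f ∧ f.Nonempty ∧ Module.finrank ℝ (vectorSpan ℝ f) + 1 = d}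

/-- The facets of `K` incident to the point `v`. -/
def facetsAt (K : Set (Space d)) (v : Space d) : Set (Set (Space d)) := {f ∈ facets K | v ∈ f}

/-- `K` is a `d`-dimensional convex polytope in `ℝ^d` which is simple. Since facets are faces in
the sense of supporting hyperplanes, distinct facets never lie in the same hyperplane. -/
structure IsSimplePolytope (K : Set (Space d)) : Prop where
  /-- `K` is a convex polytope. -/
  exists_finite : ∃ s : Set (Space d), s.Finite ∧ K = convexHull ℝ s
  /-- `K` is `d`-dimensional. -/
  affineSpan_eq_top : affineSpan ℝ K = ⊤
  /-- Each vertex is incident to exactly `d` facets. -/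
  simple : ∀ v ∈ vertices K, (facetsAt K v).ncard = d

/-- The number `h_*`: the minimal distance between a vertex and the hyperplane containing a
facet that is not incident to this vertex. -/
def hStar (K : Set (Space d)) : ℝ :=
  sInf {r | ∃ f ∈ facets K, ∃ v ∈ vertices K, v ∉ f ∧
    r = Metric.infDist v (affineSpan ℝ f : Set (Space d))}

/-- `n` is a unit vector normal to `f` and pointing out of `K` at the points of `f`. -/
structure IsUnitOutwardNormal (K f : Set (Space d)) (n : Space d) : Prop where
  norm_eq_one : ‖n‖ = 1
  normal : ∀ a ∈ f, ∀ b ∈ f, ⟪b - a, n⟫ = 0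
  outward : ∀ a ∈ f, ∀ y ∈ K, ⟪y - a, n⟫ ≤ 0

/-- A facet of a full-dimensional set has exactly one unit outward normal vector. -/
theorem existsUnique_isUnitOutwardNormal {K f : Set (Space d)} (hK : affineSpan ℝ K = ⊤)
    (hf : f ∈ facets K) : ∃! n, IsUnitOutwardNormal K f n := by
  obtain ⟨hexp, ⟨a₀, ha₀⟩, hdim⟩ := hf
  obtain ⟨l, hl⟩ := hexp ⟨a₀, ha₀⟩
  have hfK : ∀ a ∈ f, a ∈ K := fun a ha => by rw [hl] at ha; exact ha.1
  have hmax : ∀ a ∈ f, ∀ y ∈ K, l y ≤ l a := fun a ha => by rw [hl] at ha; exact ha.2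
  have hV : vectorSpan ℝ K = ⊤ := by
    rw [← direction_affineSpan, hK, AffineSubspace.direction_top]
  -- a unit vector normal to the facet on which the set is not flat
  have key : ∀ n : Space d, (∀ y ∈ K, ⟪y - a₀, n⟫ = 0) → n = 0 := by
    intro n hn
    have h1 : vectorSpan ℝ K ≤ (ℝ ∙ n)ᗮ := by
      rw [vectorSpan_eq_span_vsub_set_right ℝ (hfK a₀ ha₀), Submodule.span_le]
      rintro _ ⟨y, hy, rfl⟩
      rw [SetLike.mem_coe, Submodule.mem_orthogonal_singleton_iff_inner_left]
      exact hn y hy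
    rw [hV] at h1
    have h2 : n ∈ (ℝ ∙ n)ᗮ := h1 Submodule.mem_top
    rw [Submodule.mem_orthogonal_singleton_iff_inner_left] at h2
    exact inner_self_eq_zero.mp h2
  set m : Space d := (InnerProductSpace.toDual ℝ (Space d)).symm l with hm
  have hml : ∀ y : Space d, ⟪y, m⟫ = l y := fun y => by
    rw [real_inner_comm, hm, InnerProductSpace.toDual_symm_apply]
  have hm0 : m ≠ 0 := by
    intro h0
    have hl0 : ∀ y, l y = 0 := fun y => by rw [← hml, h0, inner_zero_right]
    have : f = K := by
      rw [hl]; ext y; simp [hl0]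
    rw [this, hV, finrank_top, finrank_euclideanSpace_fin] at hdim
    omega
  have hmn : 0 < ‖m‖ := norm_pos_iff.mpr hm0
  have hN : IsUnitOutwardNormal K f (‖m‖⁻¹ • m) := by
    refine ⟨?_, ?_, ?_⟩
    · rw [norm_smul, norm_inv, norm_norm, inv_mul_cancel₀ hmn.ne']
    · intro a ha b hb
      have : l b = l a := le_antisymm (hmax a ha b (hfK b hb)) (hmax b hb a (hfK a ha))
      rw [inner_smul_right, hml, map_sub, this, sub_self, mul_zero]
    · intro a ha y hy
      rw [inner_smul_right, hml, map_sub]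
      exact mul_nonpos_of_nonneg_of_nonpos (inv_nonneg.mpr hmn.le)
        (sub_nonpos.mpr (hmax a ha y hy))
  refine ⟨_, hN, ?_⟩
  intro n hn
  set N := ‖m‖⁻¹ • m
  -- both vectors lie in the orthogonal complement of the facet, which is a line
  have hperp : ∀ p : Space d, IsUnitOutwardNormal K f p → p ∈ (vectorSpan ℝ f)ᗮ := by
    intro p hp
    rw [Submodule.mem_orthogonal]
    intro u hu
    have h1 : vectorSpan ℝ f ≤ (ℝ ∙ p)ᗮ := by
      rw [vectorSpan_eq_span_vsub_set_right ℝ ha₀, Submodule.span_le]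
      rintro _ ⟨y, hy, rfl⟩
      rw [SetLike.mem_coe, Submodule.mem_orthogonal_singleton_iff_inner_left]
      exact hp.normal a₀ ha₀ y hy
    exact Submodule.mem_orthogonal_singleton_iff_inner_left.mp (h1 hu)
  have hfr : Module.finrank ℝ (vectorSpan ℝ f)ᗮ = 1 := by
    have := (vectorSpan ℝ f).finrank_add_finrank_orthogonal
    rw [finrank_euclideanSpace_fin] at this
    omega
  have hN0 : (⟨N, hperp N hN⟩ : (vectorSpan ℝ f)ᗮ) ≠ 0 := by
    intro h
    have : N = 0 := congrArg Subtype.val h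
    have h1 := hN.norm_eq_one
    rw [this, norm_zero] at h1
    exact zero_ne_one h1
  obtain ⟨t, ht⟩ := (finrank_eq_one_iff_of_nonzero' _ hN0).mp hfr ⟨n, hperp n hn⟩
  have ht' : n = t • N := (congrArg Subtype.val ht).symm
  have habs : |t| = 1 := by
    have h1 := hn.norm_eq_one
    rwa [ht', norm_smul, hN.norm_eq_one, mul_one, Real.norm_eq_abs] at h1
  rcases (abs_eq zero_le_one).mp habs with h1 | h1
  · rw [ht', h1, one_smul]
  · exfalso
    have hz : N = 0 := key N fun y hy => by
      have h2 := hn.outward a₀ ha₀ y hy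
      rw [ht', h1, inner_smul_right] at h2
      have h3 := hN.outward a₀ ha₀ y hy
      linarith
    have h4 := hN.norm_eq_one
    rw [hz, norm_zero] at h4
    exact zero_ne_one h4

/-- The unit outward normal vector `n_f` of the facet `f` of `K`. -/
def outwardNormal (K f : Set (Space d)) : Space d := Classical.epsilon (IsUnitOutwardNormal K f)

/-- The affine function `h_f(x) = (a - x) · n_f`, where `a` is any point of the facet `f` (the
value does not depend on `a`). On `K` it is the distance to the hyperplane containing `f`. -/
def facetHeight (K f : Set (Space d)) (x : Space d) : ℝ :=
  ⟪Classical.epsilon (fun a => a ∈ f) - x, outwardNormal K f⟫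

/-- An enumeration `f_1, …, f_d` of the facets incident to the vertex `v`. -/
def facetEnum (K : Set (Space d)) (v : Space d) : Fin d → Set (Space d) :=
  Classical.epsilon fun e => Set.BijOn e Set.univ (facetsAt K v)

/-- The matrix `M_v` whose columns are the unit outward normals of the facets incident to `v`. -/
def normalMatrix (K : Set (Space d)) (v : Space d) : Matrix (Fin d) (Fin d) ℝ :=
  Matrix.of fun i j => outwardNormal K (facetEnum K v j) i

/-- The weight `w_v(x) = |det M_v| ∏ h_f(x)`, the product being over the facets not incident to
`v`. The absolute value makes the determinant independent of the enumeration of the facets; it is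
the determinant for an enumeration for which this is positive. -/
def weight (K : Set (Space d)) (v x : Space d) : ℝ :=
  |(normalMatrix K v).det| * ∏ᶠ f ∈ facets K \ facetsAt K v, facetHeight K f x

/-- The sum `W` of the weights of all vertices. -/
def totalWeight (K : Set (Space d)) (x : Space d) : ℝ := ∑ᶠ u ∈ vertices K, weight K u x

/-- The Wachspress coordinate `φ_v = w_v / W`, as a rational function on `ℝ^d`. -/
def coord (K : Set (Space d)) (v x : Space d) : ℝ := weight K v x / totalWeight K x

/-- The partial derivative `∂g/∂x_i`. -/
def partialDeriv (i : Fin d) (g : Space d → ℝ) : Space d → ℝ :=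
  fun x => lineDeriv ℝ g x (EuclideanSpace.single i 1)

/-- The derivative `D^α g = ∂^{|α|} g / ∂x_1^{α_1} ⋯ ∂x_d^{α_d}`. -/
def multiDeriv (α : Fin d → ℕ) (g : Space d → ℝ) : Space d → ℝ :=
  (List.finRange d).foldr (fun i h => (partialDeriv i)^[α i] h) g

end Wachspress

end

/-!
The coordinate `φ_v = w_v / W` is a quotient of polynomials whose derivatives of every order are
controlled by the diameter `h_K`, so everything rests on a lower bound for the denominator.

*Lower bound.* Let `x ∈ K`. As `K` is the convex hull of its vertices, `x` is a convex combination of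
at most `N_V` vertices, and some vertex `u` has a coefficient of at least `1 / N_V` (the proof uses
`1 / (N_V + 1)`, to avoid division by zero). For a facet `f` that misses `u` the affine function
`h_f` is nonnegative on `K` and at least `h_* ≥ c h_K` at `u`, so that `h_f(x)` is at least
`c h_K / (N_V + 1)`. Hence the product in `w_u(x)` is bounded below by a multiple of `h_K ^ m`, where
`m = |F| - d`. It remains to bound `|det M_u|` from below (`hStar_pow_le_abs_det`). For each of the
`d` facets `f_i` at `u` there is a vertex `u_i` that lies in all the other facets at `u` but not in
`f_i` (`exists_vertex_opposite`). The matrix `A` with rows `u_i - u` satisfies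
`A M_u = diag(-h_{f_i}(u_i))`, and therefore `h_* ^ d ≤ |det A| |det M_u| ≤ d! h_K ^ d |det M_u|`.

*Polytope theory.* The existence of `u_i`, like the independence of the normals at `u`, uses that
near `u` the polytope is the cone cut out by the facets at `u`. This follows from the representation
of `K` by its facet inequalities, `mem_of_facetHeight_nonneg`.

*Upper bounds.* The class of smooth functions with `‖D^n f(x)‖ ≤ A a ^ n` for all `n` is closed
under products, the rates `a` being added. On `K`, a function `h_f` belongs to it with `A = h_K` and
`a = 1 / h_K`, so `w_v` belongs to it with `A = d! h_K ^ m` and `a = N_F / h_K`. After division of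
numerator and denominator by `h_K ^ m`, the bounds for reciprocals and products give a bound for the
`n`-th derivative of `φ_v` that is a constant times `(N_F / h_K) ^ n`
(`GeometricDerivBound.norm_iteratedFDeriv_div_le`).
-/

/-! ### Iterated derivatives of products and quotients -/

namespace Wachspress

/-- The derivatives of all orders of the smooth function `f` at `x` grow at most geometrically:
`‖D^n f(x)‖ ≤ A a^n`. The length scale of `f` is `a⁻¹`. -/
def GeometricDerivBound {E : Type*} [NormedAddCommGroup E] [NormedSpace ℝ E] (f : E → ℝ) (x : E)
    (A a : ℝ) : Prop :=
  ContDiff ℝ ∞ f ∧ ∀ n : ℕ, ‖iteratedFDeriv ℝ n f x‖ ≤ A * a ^ n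

section Calculus

variable {E : Type*} [NormedAddCommGroup E] [NormedSpace ℝ E]

namespace GeometricDerivBound

variable {f g : E → ℝ} {x : E} {A B a b : ℝ}

theorem nonneg (hf : GeometricDerivBound f x A a) : 0 ≤ A := by
  simpa using (norm_nonneg _).trans (hf.2 0)

theorem mono (hf : GeometricDerivBound f x A a) (ha : 0 ≤ a) (hAB : A ≤ B) (hab : a ≤ b) :
    GeometricDerivBound f x B b :=
  ⟨hf.1, fun n => (hf.2 n).trans (by
    have := hf.nonneg.trans hAB
    gcongr)⟩

theorem mul (hf : GeometricDerivBound f x A a) (hg : GeometricDerivBound g x B b) :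
    GeometricDerivBound (fun y => f y * g y) x (A * B) (a + b) := by
  refine ⟨hf.1.mul hg.1, fun n => ?_⟩
  refine (norm_iteratedFDeriv_mul_le hf.1 hg.1 x (n := n) (by exact_mod_cast le_top)).trans ?_
  rw [add_pow, Finset.mul_sum]
  refine Finset.sum_le_sum fun i _ => ?_
  calc (n.choose i : ℝ) * ‖iteratedFDeriv ℝ i f x‖ * ‖iteratedFDeriv ℝ (n - i) g x‖
      ≤ (n.choose i : ℝ) * (A * a ^ i) * (B * b ^ (n - i)) :=
        mul_le_mul (mul_le_mul_of_nonneg_left (hf.2 i) (by positivity)) (hg.2 _) (norm_nonneg _)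
          (mul_nonneg (by positivity) ((norm_nonneg _).trans (hf.2 i)))
    _ = A * B * (a ^ i * b ^ (n - i) * (n.choose i : ℝ)) := by ring

theorem const (r : ℝ) (x : E) : GeometricDerivBound (fun _ : E => r) x |r| 0 := by
  refine ⟨contDiff_const, fun n => ?_⟩
  rcases n with _ | n
  · simp
  · simp [iteratedFDeriv_const_of_ne (𝕜 := ℝ) (Nat.succ_ne_zero n) r (E := E)]

theorem sum {ι : Type*} (s : Finset ι) {f : ι → E → ℝ}
    (hf : ∀ i ∈ s, GeometricDerivBound (f i) x A a) :
    GeometricDerivBound (fun y => ∑ i ∈ s, f i y) x (s.card * A) a := by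
  refine ⟨ContDiff.sum fun i hi => (hf i hi).1, fun n => ?_⟩
  have hn : ∀ i ∈ s, ContDiff ℝ n (f i) := fun i hi => (hf i hi).1.of_le (by exact_mod_cast le_top)
  rw [iteratedFDeriv_sum hn, Finset.sum_apply, mul_assoc, ← nsmul_eq_mul]
  exact (norm_sum_le _ _).trans (Finset.sum_le_card_nsmul _ _ _ fun i hi => (hf i hi).2 n)

theorem prod {ι : Type*} (s : Finset ι) {f : ι → E → ℝ}
    (hf : ∀ i ∈ s, GeometricDerivBound (f i) x A a) :
    GeometricDerivBound (fun y => ∏ i ∈ s, f i y) x (A ^ s.card) (s.card * a) := by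
  classical
  induction s using Finset.induction_on with
  | empty => simpa using const (E := E) 1 x
  | insert i s hi ih =>
    simp only [Finset.prod_insert hi, Finset.card_insert_of_notMem hi]
    convert! (hf i (Finset.mem_insert_self _ _)).mul
      (ih fun j hj => hf j (Finset.mem_insert_of_mem hj)) using 1
    · ring
    · push_cast; ring

end GeometricDerivBound

/-- The function is affine with gradient `-p`, so only the orders zero and one contribute. -/
theorem geometricDerivBound_inner_sub {d : ℕ} {p q x : Space d} {A a : ℝ}
    (h0 : |⟪q - x, p⟫| ≤ A) (h1 : ‖p‖ ≤ A * a) (ha : 0 ≤ a) :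
    GeometricDerivBound (fun y => ⟪q - y, p⟫) x A a := by
  have hA : 0 ≤ A := (abs_nonneg _).trans h0
  have hd : fderiv ℝ (fun y : Space d => ⟪q - y, p⟫) = fun _ => -innerSL ℝ p := by
    funext y
    refine HasFDerivAt.fderiv ?_
    have h2 : HasFDerivAt (fun y : Space d => ⟪q, p⟫ - innerSL ℝ p y) (0 - innerSL ℝ p) y :=
      (hasFDerivAt_const _ _).sub (innerSL ℝ p).hasFDerivAt
    rw [zero_sub] at h2
    refine h2.congr_of_eventuallyEq (Filter.Eventually.of_forall fun z => ?_)
    simp only [innerSL_apply_apply]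
    rw [inner_sub_left, real_inner_comm p z]
  refine ⟨(contDiff_const.sub contDiff_id).inner ℝ contDiff_const, fun n => ?_⟩
  rcases n with _ | _ | n
  · simpa using h0
  · rw [← norm_iteratedFDeriv_fderiv, hd]
    simpa using h1
  · rw [← norm_iteratedFDeriv_fderiv, hd, iteratedFDeriv_const_of_ne (Nat.succ_ne_zero n)]
    simp only [Pi.zero_apply, norm_zero]
    positivity

/-- A bound for the `n`-th derivative, in units of `aⁿ`, of a quotient whose numerator and
denominator have derivatives of order `k` at most `A aᵏ` and `B aᵏ`, the denominator being
at least `δ`. -/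
noncomputable def quotientBound (A B δ : ℝ) (n : ℕ) : ℝ :=
  ∑ j ∈ Finset.range (n + 1), (n.choose j : ℝ) * A *
    ((n - j).factorial * ((n - j).factorial * (max 1 δ⁻¹) ^ (n - j + 1)) * (max 1 B) ^ (n - j))

theorem norm_iteratedFDeriv_inv_le {k i : ℕ} (hi : i ≤ k) {t δ : ℝ} (hδ : 0 < δ) (ht : δ ≤ t) :
    ‖iteratedFDeriv ℝ i (fun s : ℝ => s⁻¹) t‖ ≤ k.factorial * (max 1 δ⁻¹) ^ (k + 1) := by
  have htp : 0 < t := hδ.trans_le ht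
  rw [norm_iteratedFDeriv_eq_norm_iteratedDeriv, iteratedDeriv_eq_iterate]
  change ‖deriv^[i] Inv.inv t‖ ≤ _
  have hz : t ^ (-1 - (i : ℤ)) = t⁻¹ ^ (i + 1) := by
    rw [inv_pow, ← zpow_natCast, ← zpow_neg]
    congr 1
    push_cast
    ring
  rw [iter_deriv_inv, hz, norm_mul, norm_mul, norm_pow, norm_neg, norm_one, one_pow, one_mul,
    Real.norm_of_nonneg (by positivity), Real.norm_of_nonneg (by positivity)]
  gcongr
  calc t⁻¹ ^ (i + 1) ≤ (max 1 δ⁻¹) ^ (i + 1) := by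
        gcongr
        exact le_max_of_le_right (by gcongr)
    _ ≤ _ := pow_le_pow_right₀ (le_max_left _ _) (by omega)

theorem GeometricDerivBound.norm_iteratedFDeriv_div_le {f g : E → ℝ} {x : E} {A B a δ : ℝ}
    (hf : GeometricDerivBound f x A a) (hg : GeometricDerivBound g x B a) (ha : 0 ≤ a)
    (hδ : 0 < δ) (hgx : δ ≤ g x) (n : ℕ) :
    ‖iteratedFDeriv ℝ n (fun y => f y / g y) x‖ ≤ quotientBound A B δ n * a ^ n := by
  set U : Set E := g ⁻¹' Set.Ioi 0 with hU
  have hUo : IsOpen U := isOpen_Ioi.preimage hg.1.continuous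
  have hx : x ∈ U := hδ.trans_le hgx
  have hinv : ContDiffOn ℝ ∞ (fun s : ℝ => s⁻¹) (Set.Ioi 0) :=
    contDiffOn_inv ℝ |>.mono fun s (hs : 0 < s) => hs.ne'
  -- the reciprocal, by the bound for compositions, in which the derivatives of the inner function
  -- must be at most `D ^ i`; the value `D = max 1 B * a` absorbs the factor `B`
  have hI : ∀ k : ℕ, ‖iteratedFDerivWithin ℝ k ((fun s : ℝ => s⁻¹) ∘ g) U x‖ ≤
      k.factorial * (k.factorial * (max 1 δ⁻¹) ^ (k + 1)) * (max 1 B * a) ^ k := by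
    intro k
    refine norm_iteratedFDerivWithin_comp_le (N := ∞) hinv hg.1.contDiffOn
      (by exact_mod_cast le_top) isOpen_Ioi.uniqueDiffOn hUo.uniqueDiffOn (fun y hy => hy) hx
      (fun i hi => ?_) (fun i h1 hi => ?_)
    · rw [iteratedFDerivWithin_of_isOpen i isOpen_Ioi hx]
      exact norm_iteratedFDeriv_inv_le hi hδ hgx
    · rw [iteratedFDerivWithin_of_isOpen i hUo hx, mul_pow]
      refine (hg.2 i).trans (mul_le_mul_of_nonneg_right ?_ (by positivity))
      exact (le_max_right 1 B).trans (le_self_pow₀ (le_max_left _ _) (by omega))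
  have hcomp : ContDiffOn ℝ ∞ ((fun s : ℝ => s⁻¹) ∘ g) U :=
    hinv.comp hg.1.contDiffOn fun y hy => hy
  have hmul := norm_iteratedFDerivWithin_mul_le (N := ∞) hf.1.contDiffOn hcomp hUo.uniqueDiffOn hx
    (n := n) (by exact_mod_cast le_top)
  rw [← iteratedFDerivWithin_of_isOpen n hUo hx]
  refine hmul.trans ?_
  rw [quotientBound, Finset.sum_mul]
  refine Finset.sum_le_sum fun j hj => ?_
  have hjn : j ≤ n := Nat.lt_succ_iff.mp (Finset.mem_range.mp hj)
  rw [iteratedFDerivWithin_of_isOpen j hUo hx]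
  calc _ ≤ (n.choose j : ℝ) * (A * a ^ j) * ((n - j).factorial * ((n - j).factorial *
        (max 1 δ⁻¹) ^ (n - j + 1)) * (max 1 B * a) ^ (n - j)) :=
        mul_le_mul (mul_le_mul_of_nonneg_left (hf.2 j) (by positivity)) (hI _) (norm_nonneg _)
          (mul_nonneg (by positivity) ((norm_nonneg _).trans (hf.2 j)))
    _ = _ := by
        obtain ⟨m, rfl⟩ := Nat.exists_eq_add_of_le hjn
        simp only [Nat.add_sub_cancel_left, mul_pow, pow_add]
        ring

end Calculus

/-! ### Iterated partial derivatives -/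

variable {d : ℕ}

/-- On `U`, the function `h` is the `n`-th derivative of `g`, evaluated at fixed directions of
length at most one. -/
def IsDirectionalDeriv (U : Set (Space d)) (g : Space d → ℝ) (n : ℕ) (h : Space d → ℝ) : Prop :=
  ∃ m : Fin n → Space d, (∀ j, ‖m j‖ ≤ 1) ∧ ∀ y ∈ U, h y = iteratedFDeriv ℝ n g y m

namespace IsDirectionalDeriv

variable {U : Set (Space d)} {g h : Space d → ℝ} {n : ℕ}

theorem partialDeriv (hU : IsOpen U) (hg : ContDiffOn ℝ ∞ g U) (hh : IsDirectionalDeriv U g n h)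
    (i : Fin d) : IsDirectionalDeriv U g (n + 1) (partialDeriv i h) := by
  obtain ⟨m, hm, h1⟩ := hh
  refine ⟨Fin.cons (EuclideanSpace.single i 1) m, fun j => ?_, fun y hy => ?_⟩
  · refine Fin.cases ?_ (fun j => ?_) j
    · simp
    · simpa using hm j
  · have hd : DifferentiableAt ℝ (iteratedFDeriv ℝ n g) y :=
      (hg.contDiffAt (hU.mem_nhds hy)).differentiableAt_iteratedFDeriv (by
        exact_mod_cast ENat.natCast_lt_top n)
    have h2 : HasFDerivAt (fun z => iteratedFDeriv ℝ n g z m)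
        ((ContinuousMultilinearMap.apply ℝ (fun _ : Fin n => Space d) ℝ m).comp
          (fderiv ℝ (iteratedFDeriv ℝ n g) y)) y :=
      (ContinuousMultilinearMap.apply ℝ (fun _ : Fin n => Space d) ℝ m).hasFDerivAt.comp y
        hd.hasFDerivAt
    have h3 := h2.congr_of_eventuallyEq
      (Filter.eventuallyEq_of_mem (hU.mem_nhds hy) (fun z hz => h1 z hz))
    rw [Wachspress.partialDeriv, (h3.hasLineDerivAt _).lineDeriv, iteratedFDeriv_succ_apply_left]
    simp

theorem iterate_partialDeriv (hU : IsOpen U) (hg : ContDiffOn ℝ ∞ g U)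
    (hh : IsDirectionalDeriv U g n h) (i : Fin d) (k : ℕ) :
    IsDirectionalDeriv U g (n + k) ((Wachspress.partialDeriv i)^[k] h) := by
  induction k with
  | zero => exact hh
  | succ k ih =>
    rw [Function.iterate_succ_apply']
    exact ih.partialDeriv hU hg i

theorem foldr_partialDeriv (hU : IsOpen U) (hg : ContDiffOn ℝ ∞ g U) (α : Fin d → ℕ)
    (l : List (Fin d)) : IsDirectionalDeriv U g (l.map α).sum
      (l.foldr (fun i h => (Wachspress.partialDeriv i)^[α i] h) g) := by
  induction l with
  | nil => exact ⟨Fin.elim0, fun j => j.elim0, fun y _ => (iteratedFDeriv_zero_apply _).symm⟩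
  | cons i l ih =>
    rw [List.map_cons, List.sum_cons, add_comm, List.foldr_cons]
    exact ih.iterate_partialDeriv hU hg i (α i)

end IsDirectionalDeriv

/-- A partial derivative of order `n` is a value of the `n`-th derivative on unit vectors. -/
theorem abs_multiDeriv_le {U : Set (Space d)} (hU : IsOpen U) {g : Space d → ℝ}
    (hg : ContDiffOn ℝ ∞ g U) (α : Fin d → ℕ) {x : Space d} (hx : x ∈ U) :
    |multiDeriv α g x| ≤ ‖iteratedFDeriv ℝ (∑ i, α i) g x‖ := by
  obtain ⟨m, hm, h⟩ := IsDirectionalDeriv.foldr_partialDeriv hU hg α (List.finRange d)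
  rw [multiDeriv, h x hx, Fin.sum_univ_def, ← Real.norm_eq_abs]
  exact ContinuousMultilinearMap.unit_le_opNorm _ ((pi_norm_le_iff_of_nonneg zero_le_one).2 hm)

/-! ### Facet heights, vertices and faces -/

open Set

theorem facetHeight_add (K f : Set (Space d)) (x y : Space d) :
    facetHeight K f (x + y) = facetHeight K f x - ⟪y, outwardNormal K f⟫ := by
  rw [facetHeight, facetHeight, ← sub_sub, inner_sub_left]

theorem facetHeight_sum (K f : Set (Space d)) {s : Finset (Space d)} {w : Space d → ℝ}
    (hw : ∑ v ∈ s, w v = 1) :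
    facetHeight K f (∑ v ∈ s, w v • v) = ∑ v ∈ s, w v * facetHeight K f v := by
  simp only [facetHeight, inner_sub_left, mul_sub, Finset.sum_sub_distrib, ← Finset.sum_mul, hw,
    one_mul, sum_inner, real_inner_smul_left]

namespace IsSimplePolytope

variable {K : Set (Space d)} (hK : IsSimplePolytope K)

include hK

theorem convex : Convex ℝ K := by
  obtain ⟨s, -, rfl⟩ := hK.exists_finite
  exact convex_convexHull ℝ s

theorem isCompact : IsCompact K := by
  obtain ⟨s, hs, rfl⟩ := hK.exists_finite
  exact hs.isCompact_convexHull ℝ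

theorem finite_extremePoints : (K.extremePoints ℝ).Finite := by
  obtain ⟨s, hs, rfl⟩ := hK.exists_finite
  exact hs.subset extremePoints_convexHull_subset

/-- The Krein–Milman theorem for the face `G`, whose extreme points are extreme points of `K`. -/
theorem eq_convexHull_extremePoints_of_isExposed {G : Set (Space d)} (hG : IsExposed ℝ K G) :
    G = convexHull ℝ (K.extremePoints ℝ ∩ G) := by
  have h1 := closure_convexHull_extremePoints (hG.isCompact hK.isCompact) (hG.convex hK.convex)
  rw [hG.isExtreme.extremePoints_eq, inter_comm,
    ((hK.finite_extremePoints.subset inter_subset_left).isClosed_convexHull ℝ).closure_eq] at h1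
  exact h1.symm

theorem vertices_eq_extremePoints : vertices K = K.extremePoints ℝ := by
  ext v
  refine ⟨fun hv => isExtreme_singleton.mp (IsExposed.isExtreme hv), fun hv => ?_⟩
  -- `v` is strictly separated from the hull of the other extreme points
  have hT : (K.extremePoints ℝ \ {v}).Finite := hK.finite_extremePoints.subset sdiff_subset
  have hvT : v ∉ convexHull ℝ (K.extremePoints ℝ \ {v}) := fun h =>
    (convexHull_min (sdiff_subset_sdiff_left extremePoints_subset)
      (hK.convex.mem_extremePoints_iff_convex_sdiff.mp hv).2 h).2 rfl
  obtain ⟨l, u, hlu, hl⟩ := geometric_hahn_banach_point_closed (convex_convexHull ℝ _)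
    (hT.isClosed_convexHull ℝ) hvT
  have hG : IsExposed ℝ K ((-l).toExposed K) := ContinuousLinearMap.toExposed.isExposed
  have hGv : (-l).toExposed K ⊆ {v} := by
    rw [hK.eq_convexHull_extremePoints_of_isExposed hG, ← convexHull_singleton (𝕜 := ℝ) v]
    refine convexHull_mono fun w hw => ?_
    by_contra hwv
    have h1 := hl w (subset_convexHull ℝ _ ⟨hw.1, hwv⟩)
    have h2 : -l v ≤ -l w := hw.2.2 v hv.1
    linarith
  obtain ⟨x, hxK, hx⟩ := hK.isCompact.exists_isMaxOn ⟨v, hv.1⟩ (-l).continuous.continuousOn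
  have hxG : x ∈ (-l).toExposed K := ⟨hxK, fun y hy => hx hy⟩
  have hv' : (-l).toExposed K = {v} :=
    hGv.antisymm (singleton_subset_iff.mpr (hGv hxG ▸ hxG))
  change IsExposed ℝ K {v}
  rwa [hv'] at hG

theorem finite_vertices : (vertices K).Finite :=
  hK.vertices_eq_extremePoints ▸ hK.finite_extremePoints

theorem eq_convexHull_of_isExposed {G : Set (Space d)} (hG : IsExposed ℝ K G) :
    G = convexHull ℝ (vertices K ∩ G) :=
  hK.vertices_eq_extremePoints ▸ hK.eq_convexHull_extremePoints_of_isExposed hG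

theorem exists_convexCombination {x : Space d} (hx : x ∈ K) : ∃ w : Space d → ℝ,
    (∀ v ∈ hK.finite_vertices.toFinset, 0 ≤ w v) ∧ ∑ v ∈ hK.finite_vertices.toFinset, w v = 1 ∧
      ∑ v ∈ hK.finite_vertices.toFinset, w v • v = x := by
  rw [← Finset.mem_convexHull', Finite.coe_toFinset]
  have hV : vertices K ∩ K = vertices K :=
    inter_eq_left.mpr fun v (hv : IsExposed ℝ K {v}) => hv.subset rfl
  have h := hK.eq_convexHull_of_isExposed (IsExposed.refl (𝕜 := ℝ) K)
  rw [hV] at h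
  rwa [h] at hx

/-! ### Facets and the facet inequalities -/

theorem isUnitOutwardNormal {f : Set (Space d)} (hf : f ∈ facets K) :
    IsUnitOutwardNormal K f (outwardNormal K f) :=
  Classical.epsilon_spec (existsUnique_isUnitOutwardNormal hK.affineSpan_eq_top hf).exists

theorem facetHeight_eq {f : Set (Space d)} (hf : f ∈ facets K) {a : Space d} (ha : a ∈ f)
    (x : Space d) : facetHeight K f x = ⟪a - x, outwardNormal K f⟫ := by
  have h1 := (hK.isUnitOutwardNormal hf).normal a ha _ (Classical.epsilon_spec hf.2.1)
  rw [inner_sub_left] at h1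
  rw [facetHeight, inner_sub_left, inner_sub_left]
  linarith

theorem facetHeight_nonneg {f : Set (Space d)} (hf : f ∈ facets K) {x : Space d} (hx : x ∈ K) :
    0 ≤ facetHeight K f x := by
  obtain ⟨a, ha⟩ := hf.2.1
  have h1 := (hK.isUnitOutwardNormal hf).outward a ha x hx
  rw [hK.facetHeight_eq hf ha, ← neg_sub, inner_neg_left]
  linarith

theorem facetHeight_le_diam {f : Set (Space d)} (hf : f ∈ facets K) {x : Space d} (hx : x ∈ K) :
    facetHeight K f x ≤ Metric.diam K := by
  obtain ⟨a, ha⟩ := hf.2.1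
  rw [hK.facetHeight_eq hf ha]
  refine (real_inner_le_norm _ _).trans ?_
  rw [(hK.isUnitOutwardNormal hf).norm_eq_one, mul_one, ← dist_eq_norm]
  exact Metric.dist_le_diam_of_mem hK.isCompact.isBounded (hf.1.subset ha) hx

/-- One inclusion holds by the definition of the normal, the other by counting dimensions. -/
theorem vectorSpan_facet {f : Set (Space d)} (hf : f ∈ facets K) :
    vectorSpan ℝ f = (ℝ ∙ outwardNormal K f)ᗮ := by
  have hn := hK.isUnitOutwardNormal hf
  obtain ⟨a, ha⟩ := hf.2.1
  refine Submodule.eq_of_le_of_finrank_eq ?_ ?_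
  · rw [vectorSpan_eq_span_vsub_set_right ℝ ha, Submodule.span_le]
    rintro _ ⟨y, hy, rfl⟩
    rw [SetLike.mem_coe, Submodule.mem_orthogonal_singleton_iff_inner_left]
    exact hn.normal a ha y hy
  · have h0 : outwardNormal K f ≠ 0 := by
      rw [← norm_ne_zero_iff, hn.norm_eq_one]
      exact one_ne_zero
    have h1 := (ℝ ∙ outwardNormal K f).finrank_add_finrank_orthogonal
    rw [finrank_span_singleton h0, finrank_euclideanSpace_fin] at h1
    have := hf.2.2
    omega

theorem mem_affineSpan_facet_iff {f : Set (Space d)} (hf : f ∈ facets K) {x : Space d} :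
    x ∈ affineSpan ℝ f ↔ facetHeight K f x = 0 := by
  obtain ⟨a, ha⟩ := hf.2.1
  rw [← AffineSubspace.vsub_right_mem_direction_iff_mem (mem_affineSpan ℝ ha), vsub_eq_sub,
    direction_affineSpan, hK.vectorSpan_facet hf,
    Submodule.mem_orthogonal_singleton_iff_inner_left, hK.facetHeight_eq hf ha, ← neg_sub,
    inner_neg_left, neg_eq_zero]

theorem mem_facet_iff {f : Set (Space d)} (hf : f ∈ facets K) {x : Space d} (hx : x ∈ K) :
    x ∈ f ↔ facetHeight K f x = 0 := by
  rw [← hK.mem_affineSpan_facet_iff hf]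
  refine ⟨fun h => mem_affineSpan ℝ h, fun h => ?_⟩
  obtain ⟨a, ha⟩ := hf.2.1
  obtain ⟨l, hl⟩ := hf.1 hf.2.1
  have hmax : ∀ y ∈ f, ∀ z ∈ K, l z ≤ l y := fun y hy => by
    rw [hl] at hy
    exact hy.2
  have h1 : vectorSpan ℝ f ≤ LinearMap.ker (l : Space d →ₗ[ℝ] ℝ) := by
    rw [vectorSpan_eq_span_vsub_set_right ℝ ha, Submodule.span_le]
    rintro _ ⟨y, hy, rfl⟩
    have h2 := hmax y hy a (hf.1.subset ha)
    have h3 := hmax a ha y (hf.1.subset hy)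
    have h4 : l y - l a = 0 := by linarith
    simpa using h4
  have h5 : x -ᵥ a ∈ vectorSpan ℝ f := by
    rw [← direction_affineSpan]
    exact AffineSubspace.vsub_mem_direction h (mem_affineSpan ℝ ha)
  have h6 : l (x - a) = 0 := h1 h5
  rw [map_sub, sub_eq_zero] at h6
  rw [hl]
  exact ⟨hx, fun y hy => h6 ▸ hmax a ha y hy⟩

theorem facetHeight_pos {f : Set (Space d)} (hf : f ∈ facets K) {x : Space d} (hx : x ∈ K)
    (hxf : x ∉ f) : 0 < facetHeight K f x :=
  (hK.facetHeight_nonneg hf hx).lt_of_ne' fun h => hxf ((hK.mem_facet_iff hf hx).mpr h)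

theorem hStar_le_facetHeight {f : Set (Space d)} (hf : f ∈ facets K) {v : Space d}
    (hv : v ∈ vertices K) (hvf : v ∉ f) : hStar K ≤ facetHeight K f v := by
  have hvK : v ∈ K := IsExposed.subset hv rfl
  have hn := (hK.isUnitOutwardNormal hf).norm_eq_one
  have hle : hStar K ≤ Metric.infDist v (affineSpan ℝ f : Set (Space d)) := by
    refine csInf_le ⟨0, ?_⟩ ⟨f, hf, v, hv, hvf, rfl⟩
    rintro _ ⟨_, _, _, _, _, rfl⟩
    exact Metric.infDist_nonneg
  refine hle.trans ?_
  -- the orthogonal projection of `v` to the hyperplane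
  have hp : v + facetHeight K f v • outwardNormal K f ∈ affineSpan ℝ f := by
    rw [hK.mem_affineSpan_facet_iff hf, facetHeight_add, real_inner_smul_left,
      real_inner_self_eq_norm_sq, hn]
    ring
  refine (Metric.infDist_le_dist_of_mem hp).trans_eq ?_
  rw [dist_self_add_right, norm_smul, hn, mul_one,
    Real.norm_of_nonneg (hK.facetHeight_nonneg hf hvK)]

/-- A facet is determined by its vertices. -/
theorem finite_facets : (facets K).Finite := by
  refine Set.Finite.of_finite_image (f := fun f => vertices K ∩ f)
    (hK.finite_vertices.finite_subsets.subset ?_) fun f hf g hg hfg => ?_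
  · rintro _ ⟨f, -, rfl⟩
    exact inter_subset_left
  · have hfg' : vertices K ∩ f = vertices K ∩ g := hfg
    rw [hK.eq_convexHull_of_isExposed hf.1, hK.eq_convexHull_of_isExposed hg.1, hfg']

/-- A point outside `K` violates a facet inequality: it is joined by a segment to an interior
point in general position, and where this segment leaves `K`, every supporting hyperplane meets
`K` in a facet. -/
theorem mem_of_facetHeight_nonneg {y : Space d} (hy : ∀ f ∈ facets K, 0 ≤ facetHeight K f y) :
    y ∈ K := by
  by_contra hyK
  have hint : (interior K).Nonempty :=
    hK.convex.interior_nonempty_iff_affineSpan_eq_top.mpr hK.affineSpan_eq_top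
  -- `z` avoids the proper affine subspaces spanned by `y` and vertices
  obtain ⟨z, hzK, hz⟩ : ∃ z ∈ interior K, ∀ T ⊆ vertices K,
      Module.finrank ℝ (vectorSpan ℝ T) + 1 < d → z ∉ affineSpan ℝ (insert y T) := by
    by_contra! hcon
    have hsub : interior K ⊆ ⋃ T ∈ {T | T ⊆ vertices K ∧ Module.finrank ℝ (vectorSpan ℝ T) + 1 < d},
        (affineSpan ℝ (insert y T) : Set (Space d)) := fun z hz => by
      obtain ⟨T, hT, hTd, hzT⟩ := hcon z hz
      exact mem_biUnion (show T ∈ {T | _} from ⟨hT, hTd⟩) hzT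
    -- there are finitely many of them, and they are null sets
    have hnull : MeasureTheory.volume (⋃ T ∈ {T | T ⊆ vertices K ∧
        Module.finrank ℝ (vectorSpan ℝ T) + 1 < d},
        (affineSpan ℝ (insert y T) : Set (Space d))) = 0 := by
      refine (MeasureTheory.measure_biUnion_null_iff
        (hK.finite_vertices.finite_subsets.subset fun T hT => hT.1).countable).mpr fun T hT => ?_
      refine MeasureTheory.Measure.addHaar_affineSubspace _ _ fun htop => ?_
      have h1 := finrank_vectorSpan_insert_le_set ℝ T y
      rw [← direction_affineSpan, htop, AffineSubspace.direction_top, finrank_top,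
        finrank_euclideanSpace_fin] at h1
      have := hT.2
      omega
    exact (isOpen_interior.measure_pos MeasureTheory.volume hint).ne'
      (MeasureTheory.measure_mono_null hsub hnull)
  have hzK' : z ∈ K := interior_subset hzK
  obtain ⟨p, hpK, hpi, t, ht, rfl⟩ : ∃ p ∈ K, p ∉ interior K ∧
      ∃ t ∈ Icc (0 : ℝ) 1, AffineMap.lineMap z y t = p := by
    by_contra! hcon
    have hc : IsPreconnected (AffineMap.lineMap z y '' Icc (0 : ℝ) 1) :=
      isPreconnected_Icc.image _ AffineMap.lineMap_continuous.continuousOn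
    obtain ⟨q, -, hq1, hq2⟩ := hc (interior K) Kᶜ isOpen_interior
      hK.isCompact.isClosed.isOpen_compl
      (by
        rintro _ ⟨t, ht, rfl⟩
        by_contra h
        rw [mem_union, not_or, notMem_compl_iff] at h
        exact hcon _ h.2 h.1 t ht rfl)
      ⟨z, ⟨0, by simp, by simp⟩, hzK⟩ ⟨y, ⟨1, by simp, by simp⟩, hyK⟩
    exact hq2 (interior_subset hq1)
  set p : Space d := AffineMap.lineMap z y t with hp
  have ht1 : t < 1 := ht.2.lt_of_ne fun h =>
    hyK (by rwa [hp, h, AffineMap.lineMap_apply_one] at hpK)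
  -- the face cut out by a supporting hyperplane at `p`
  obtain ⟨l, hl⟩ := geometric_hahn_banach_open_point hK.convex.interior isOpen_interior hpi
  have hlK : ∀ x ∈ K, l x ≤ l p := fun x hx => by
    have hx' : x ∈ closure (interior K) := by
      rw [hK.convex.closure_interior_eq_closure_of_nonempty_interior hint]
      exact subset_closure hx
    exact closure_minimal (fun w hw => (hl w hw).le)
      (isClosed_le l.continuous continuous_const) hx'
  have hG : IsExposed ℝ K (l.toExposed K) := ContinuousLinearMap.toExposed.isExposed
  have hpG : p ∈ l.toExposed K := ⟨hpK, hlK⟩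
  have hzG : z ∉ l.toExposed K := fun h => (hl z hzK).not_ge (h.2 p hpK)
  have hlt : Module.finrank ℝ (vectorSpan ℝ (l.toExposed K)) < d := by
    have hle : vectorSpan ℝ (l.toExposed K) ≤ LinearMap.ker (l : Space d →ₗ[ℝ] ℝ) := by
      rw [vectorSpan_eq_span_vsub_set_right ℝ hpG, Submodule.span_le]
      rintro _ ⟨x, hx, rfl⟩
      have h4 : l x - l p = 0 := sub_eq_zero.mpr (le_antisymm (hlK x hx.1) (hx.2 p hpK))
      simpa using h4
    have hne : vectorSpan ℝ (l.toExposed K) ≠ ⊤ := fun htop => by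
      have h5 : l (z - p) = 0 := hle (htop ▸ Submodule.mem_top)
      rw [map_sub, sub_eq_zero] at h5
      exact (hl z hzK).ne h5
    have := Submodule.finrank_lt hne
    rwa [finrank_euclideanSpace_fin] at this
  -- either the face is a facet, whose inequality fails at `y`, or `z` lies on the line through `y`
  -- and `p` and thus in one of the avoided subspaces
  rcases (Nat.succ_le_iff.mpr hlt).eq_or_lt with heq | hlt'
  · have hf : l.toExposed K ∈ facets K := ⟨hG, ⟨p, hpG⟩, heq⟩
    have h0 := (hK.mem_facet_iff hf hpK).mp hpG
    have hz0 := hK.facetHeight_pos hf hzK' hzG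
    have hy0 := hy _ hf
    have hlin : facetHeight K (l.toExposed K) p = (1 - t) * facetHeight K (l.toExposed K) z +
        t * facetHeight K (l.toExposed K) y := by
      rw [hp, AffineMap.lineMap_apply_module]
      simp only [facetHeight, inner_sub_left, inner_add_left, real_inner_smul_left]
      ring
    have h1 : 0 < (1 - t) * facetHeight K (l.toExposed K) z := mul_pos (by linarith) hz0
    have h2 := mul_nonneg ht.1 hy0
    linarith
  · have hspan : affineSpan ℝ (l.toExposed K) = affineSpan ℝ (vertices K ∩ l.toExposed K) := by
      conv_lhs => rw [hK.eq_convexHull_of_isExposed hG]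
      rw [affineSpan_convexHull]
    refine hz (vertices K ∩ l.toExposed K) inter_subset_left ?_ ?_
    · rwa [← direction_affineSpan, ← hspan, direction_affineSpan]
    · have hyA : y ∈ affineSpan ℝ (insert y (vertices K ∩ l.toExposed K)) :=
        mem_affineSpan ℝ (mem_insert _ _)
      have hpA : p ∈ affineSpan ℝ (insert y (vertices K ∩ l.toExposed K)) :=
        affineSpan_mono ℝ (subset_insert _ _) (hspan ▸ mem_affineSpan ℝ hpG)
      have hzp : z = AffineMap.lineMap y p (1 - t)⁻¹ := by
        have h1t : (1 - t) ≠ 0 := by linarith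
        have h2 : p - y = (1 - t) • (z - y) := by
          rw [hp, AffineMap.lineMap_apply_module]
          module
        rw [AffineMap.lineMap_apply_module', h2, smul_smul, inv_mul_cancel₀ h1t, one_smul,
          sub_add_cancel]
      rw [hzp]
      exact AffineMap.lineMap_mem _ hyA hpA

end IsSimplePolytope

/-! ### The normals at a simple vertex -/

theorem vecMul_normalMatrix (K : Set (Space d)) (v y : Space d) (j : Fin d) :
    Matrix.vecMul y.ofLp (normalMatrix K v) j = ⟪y, outwardNormal K (facetEnum K v j)⟫ := by
  simp [Matrix.vecMul, dotProduct, normalMatrix, PiLp.inner_apply, mul_comm]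

namespace IsSimplePolytope

variable {K : Set (Space d)} (hK : IsSimplePolytope K)

include hK

theorem facetEnum_bijOn {v : Space d} (hv : v ∈ vertices K) :
    BijOn (facetEnum K v) univ (facetsAt K v) := by
  have hfin : (facetsAt K v).Finite := hK.finite_facets.subset (sep_subset _ _)
  have hcard : hfin.toFinset.card = d := by
    rw [← ncard_eq_toFinset_card _ hfin]
    exact hK.simple v hv
  refine Classical.epsilon_spec (p := fun e => BijOn e univ (facetsAt K v))
    ⟨fun i => ((hfin.toFinset.equivFinOfCardEq hcard).symm i : Set (Space d)), fun i _ => ?_,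
      fun i _ j _ hij => ?_, fun f hf => ?_⟩
  · exact hfin.mem_toFinset.mp ((hfin.toFinset.equivFinOfCardEq hcard).symm i).2
  · exact (hfin.toFinset.equivFinOfCardEq hcard).symm.injective (Subtype.ext hij)
  · exact ⟨hfin.toFinset.equivFinOfCardEq hcard ⟨f, hfin.mem_toFinset.mpr hf⟩, mem_univ _, by simp⟩

/-- Near the point `v`, the polytope agrees with the cone cut out by the facets through `v`. -/
theorem exists_pos_add_smul_mem {v y : Space d} (hv : v ∈ K)
    (hy : ∀ f ∈ facetsAt K v, ⟪y, outwardNormal K f⟫ ≤ 0) : ∃ t : ℝ, 0 < t ∧ v + t • y ∈ K := by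
  have h1 : ∀ᶠ t : ℝ in nhdsWithin 0 (Ioi 0), ∀ f ∈ facets K,
      0 ≤ facetHeight K f (v + t • y) := by
    rw [Filter.eventually_all_finite hK.finite_facets]
    intro f hf
    simp only [facetHeight_add, real_inner_smul_left]
    by_cases hvf : v ∈ f
    · filter_upwards [self_mem_nhdsWithin] with t ht
      have h2 := mul_nonneg (le_of_lt ht) (neg_nonneg.mpr (hy f ⟨hf, hvf⟩))
      have h3 := hK.facetHeight_nonneg hf hv
      linarith
    · have hc : Continuous fun t : ℝ => facetHeight K f v - t * ⟪y, outwardNormal K f⟫ := by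
        fun_prop
      have h2 : ∀ᶠ t : ℝ in nhds 0, 0 < facetHeight K f v - t * ⟪y, outwardNormal K f⟫ :=
        hc.continuousAt.eventually (lt_mem_nhds (by simpa using hK.facetHeight_pos hf hv hvf))
      exact (h2.filter_mono nhdsWithin_le_nhds).mono fun t ht => ht.le
  obtain ⟨t, ht, ht0⟩ := (h1.and self_mem_nhdsWithin).exists
  exact ⟨t, ht0, hK.mem_of_facetHeight_nonneg ht⟩

/-- If the normals at a vertex were dependent, then the polytope would contain a segment with the
vertex in its interior. -/
theorem det_normalMatrix_ne_zero {v : Space d} (hv : v ∈ vertices K) :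
    (normalMatrix K v).det ≠ 0 := by
  intro h0
  have hvK : v ∈ K := IsExposed.subset hv rfl
  obtain ⟨y, hy0, hy⟩ := Matrix.exists_vecMul_eq_zero_iff.mpr h0
  have hyn : ∀ f ∈ facetsAt K v, ⟪WithLp.toLp 2 y, outwardNormal K f⟫ = 0 := by
    intro f hf
    obtain ⟨j, -, rfl⟩ := (hK.facetEnum_bijOn hv).surjOn hf
    rw [← vecMul_normalMatrix]
    exact congrFun hy j
  obtain ⟨t, ht, h1⟩ := hK.exists_pos_add_smul_mem hvK fun f hf => (hyn f hf).le
  obtain ⟨s, hs, h2⟩ := hK.exists_pos_add_smul_mem (y := -WithLp.toLp 2 y) hvK fun f hf => by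
    rw [inner_neg_left, hyn f hf, neg_zero]
  obtain ⟨l, hl⟩ : ∃ l : StrongDual ℝ (Space d), {v} = {x ∈ K | ∀ y ∈ K, l y ≤ l x} :=
    hv ⟨v, rfl⟩
  have hvl : v ∈ {x ∈ K | ∀ y ∈ K, l y ≤ l x} := hl ▸ mem_singleton v
  have h3 := hvl.2 _ h1
  have h4 := hvl.2 _ h2
  simp only [map_add, map_smul, map_neg, smul_eq_mul, add_le_iff_nonpos_right] at h3 h4
  have h5 : l (WithLp.toLp 2 y) = 0 := le_antisymm (nonpos_of_mul_nonpos_right h3 ht)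
    (neg_nonpos.mp (nonpos_of_mul_nonpos_right h4 hs))
  have h6 : v + t • WithLp.toLp 2 y ∈ {x ∈ K | ∀ y ∈ K, l y ≤ l x} :=
    ⟨h1, fun z hz => by simpa [h5] using hvl.2 z hz⟩
  rw [← hl, mem_singleton_iff, add_eq_left, smul_eq_zero] at h6
  exact hy0 (by simpa using h6.resolve_left ht.ne')

/-- The edge emanating from the vertex `v` that leaves the `i`-th facet through `v` stays in the
other facets through `v`, and so does some vertex off the `i`-th facet. -/
theorem exists_vertex_opposite {v : Space d} (hv : v ∈ vertices K) (i : Fin d) :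
    ∃ u ∈ vertices K, u ∉ facetEnum K v i ∧
      ∀ j, j ≠ i → facetHeight K (facetEnum K v j) u = 0 := by
  have hvK : v ∈ K := IsExposed.subset hv rfl
  have hf : ∀ j, facetEnum K v j ∈ facetsAt K v := fun j =>
    (hK.facetEnum_bijOn hv).mapsTo (mem_univ j)
  have hfv : ∀ j, facetHeight K (facetEnum K v j) v = 0 := fun j =>
    (hK.mem_facet_iff (hf j).1 hvK).mp (hf j).2
  have hM : IsUnit (normalMatrix K v).det := (hK.det_normalMatrix_ne_zero hv).isUnit
  -- the direction of the edge, from the basis dual to the normals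
  set y : Fin d → ℝ := -Matrix.vecMul (Pi.single i 1) (normalMatrix K v)⁻¹ with hy
  have hyM : Matrix.vecMul y (normalMatrix K v) = -Pi.single i 1 := by
    rw [hy, Matrix.neg_vecMul, Matrix.vecMul_vecMul, Matrix.nonsing_inv_mul _ hM, Matrix.vecMul_one]
  have hyn : ∀ j, ⟪WithLp.toLp 2 y, outwardNormal K (facetEnum K v j)⟫ =
      -(Pi.single i 1 : Fin d → ℝ) j := fun j => by
    rw [← vecMul_normalMatrix]
    exact congrFun hyM j
  obtain ⟨t, ht, hp⟩ := hK.exists_pos_add_smul_mem (y := WithLp.toLp 2 y) hvK fun f hf' => by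
    obtain ⟨j, -, rfl⟩ := (hK.facetEnum_bijOn hv).surjOn hf'
    rw [hyn, neg_nonpos]
    have h1 : (0 : Fin d → ℝ) ≤ Pi.single i 1 := Pi.single_nonneg.mpr zero_le_one
    exact h1 j
  -- the height over each facet is an average of its values at the vertices
  obtain ⟨w, hw0, hw1, hw⟩ := hK.exists_convexCombination hp
  have hsum : ∀ j, ∑ u ∈ hK.finite_vertices.toFinset, w u * facetHeight K (facetEnum K v j) u =
      t * (Pi.single i 1 : Fin d → ℝ) j := fun j => by
    rw [← facetHeight_sum _ _ hw1, hw, facetHeight_add, real_inner_smul_left, hyn, hfv]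
    ring
  have hVK : ∀ u ∈ hK.finite_vertices.toFinset, u ∈ K := fun u hu => by
    have hu' : IsExposed ℝ K {u} := hK.finite_vertices.mem_toFinset.mp hu
    exact hu'.subset rfl
  have hnn : ∀ j, ∀ u ∈ hK.finite_vertices.toFinset,
      0 ≤ w u * facetHeight K (facetEnum K v j) u := fun j u hu =>
    mul_nonneg (hw0 u hu) (hK.facetHeight_nonneg (hf j).1 (hVK u hu))
  obtain ⟨u, hu, hui⟩ : ∃ u ∈ hK.finite_vertices.toFinset,
      0 < w u * facetHeight K (facetEnum K v i) u := by
    by_contra! hcon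
    have h1 := Finset.sum_nonpos hcon
    rw [hsum i, Pi.single_eq_same, mul_one] at h1
    exact h1.not_gt ht
  refine ⟨u, hK.finite_vertices.mem_toFinset.mp hu, fun h => ?_, fun j hj => ?_⟩
  · rw [(hK.mem_facet_iff (hf i).1 (hVK u hu)).mp h, mul_zero] at hui
    exact hui.false
  · have h1 := hsum j
    rw [Pi.single_eq_of_ne hj, mul_zero, Finset.sum_eq_zero_iff_of_nonneg (hnn j)] at h1
    exact (mul_eq_zero.mp (h1 u hu)).resolve_left (left_ne_zero_of_mul hui.ne')

theorem diam_pos (hd : 1 ≤ d) {v : Space d} (hv : v ∈ vertices K) : 0 < Metric.diam K := by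
  obtain ⟨u, hu, huf, -⟩ := hK.exists_vertex_opposite hv ⟨0, hd⟩
  have hvf : v ∈ facetEnum K v ⟨0, hd⟩ := ((hK.facetEnum_bijOn hv).mapsTo (mem_univ _)).2
  refine (dist_pos.mpr fun h : u = v => huf (h ▸ hvf)).trans_le
    (Metric.dist_le_diam_of_mem hK.isCompact.isBounded (IsExposed.subset hu rfl)
      (IsExposed.subset hv rfl))

/-- The vectors from `v` to the opposite vertices are, up to factors of size at least `h_*`, dual to
the normals at `v`. -/
theorem hStar_pow_le_abs_det {v : Space d} (hv : v ∈ vertices K) (h0 : 0 ≤ hStar K) :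
    hStar K ^ d ≤ |(normalMatrix K v).det| * (d.factorial * Metric.diam K ^ d) := by
  have hvK : v ∈ K := IsExposed.subset hv rfl
  have hf : ∀ j, facetEnum K v j ∈ facetsAt K v := fun j =>
    (hK.facetEnum_bijOn hv).mapsTo (mem_univ j)
  choose u hu huf hu0 using hK.exists_vertex_opposite hv
  set A : Matrix (Fin d) (Fin d) ℝ := Matrix.of fun i k => (u i - v) k with hA
  have hAM : A * normalMatrix K v =
      Matrix.diagonal fun i => -facetHeight K (facetEnum K v i) (u i) := by
    ext i j
    have h1 : (A * normalMatrix K v) i j = -facetHeight K (facetEnum K v j) (u i) := by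
      rw [hK.facetHeight_eq (hf j).1 (hf j).2, ← inner_neg_left, neg_sub, ← vecMul_normalMatrix,
        Matrix.mul_apply_eq_vecMul]
      rfl
    rcases eq_or_ne i j with rfl | hij
    · rw [h1, Matrix.diagonal_apply_eq]
    · rw [h1, hu0 i j hij.symm, neg_zero, Matrix.diagonal_apply_ne _ hij]
  have hdet : |A.det| * |(normalMatrix K v).det| =
      ∏ i, facetHeight K (facetEnum K v i) (u i) := by
    rw [← abs_mul, ← Matrix.det_mul, hAM, Matrix.det_diagonal, Finset.abs_prod]
    refine Finset.prod_congr rfl fun i _ => ?_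
    rw [abs_neg, abs_of_nonneg (hK.facetHeight_nonneg (hf i).1 (IsExposed.subset (hu i) rfl))]
  have hAle : |A.det| ≤ d.factorial * Metric.diam K ^ d := by
    have h1 := Matrix.det_le (A := A) (abv := AbsoluteValue.abs) (x := Metric.diam K) fun i k => by
      refine (PiLp.norm_apply_le (u i - v) k).trans ?_
      rw [← dist_eq_norm]
      exact Metric.dist_le_diam_of_mem hK.isCompact.isBounded (IsExposed.subset (hu i) rfl) hvK
    simpa using h1
  calc hStar K ^ d = ∏ _i : Fin d, hStar K := by simp
    _ ≤ ∏ i, facetHeight K (facetEnum K v i) (u i) := Finset.prod_le_prod (fun _ _ => h0)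
        fun i _ => hK.hStar_le_facetHeight (hf i).1 (hu i) (huf i)
    _ = |(normalMatrix K v).det| * |A.det| := by rw [← hdet, mul_comm]
    _ ≤ _ := by gcongr

theorem abs_det_normalMatrix_le {v : Space d} (hv : v ∈ vertices K) :
    |(normalMatrix K v).det| ≤ d.factorial := by
  have h1 := Matrix.det_le (A := normalMatrix K v) (abv := AbsoluteValue.abs) (x := 1) fun i j => by
    refine (PiLp.norm_apply_le (outwardNormal K (facetEnum K v j)) i).trans_eq ?_
    exact (hK.isUnitOutwardNormal ((hK.facetEnum_bijOn hv).mapsTo (mem_univ j)).1).norm_eq_one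
  simpa using h1

/-! ### Bounds for the weights -/

theorem finite_facets_sdiff (v : Space d) : (facets K \ facetsAt K v).Finite :=
  hK.finite_facets.subset sdiff_subset

theorem weight_eq (v : Space d) : weight K v = fun x => |(normalMatrix K v).det| *
    ∏ f ∈ (hK.finite_facets_sdiff v).toFinset, facetHeight K f x := by
  funext x
  rw [weight, finprod_mem_eq_finite_toFinset_prod _ (hK.finite_facets_sdiff v)]

theorem totalWeight_eq :
    totalWeight K = fun x => ∑ u ∈ hK.finite_vertices.toFinset, weight K u x := by
  funext x
  rw [totalWeight, finsum_mem_eq_finite_toFinset_sum _ hK.finite_vertices]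

theorem card_facets_sdiff {v : Space d} (hv : v ∈ vertices K) :
    (hK.finite_facets_sdiff v).toFinset.card = (facets K).ncard - d := by
  rw [← ncard_eq_toFinset_card _ (hK.finite_facets_sdiff v), ncard_sdiff (t := facets K)
    (s := facetsAt K v) (sep_subset _ _) (hK.finite_facets.subset (sep_subset _ _))]
  exact congrArg _ (hK.simple v hv)

theorem weight_nonneg (v : Space d) {x : Space d} (hx : x ∈ K) : 0 ≤ weight K v x := by
  rw [hK.weight_eq v]
  exact mul_nonneg (abs_nonneg _) (Finset.prod_nonneg fun f hf =>
    hK.facetHeight_nonneg ((hK.finite_facets_sdiff v).mem_toFinset.mp hf).1 hx)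

theorem geometricDerivBound_weight (hH : 0 < Metric.diam K) {NF : ℕ} (hNF : (facets K).ncard ≤ NF)
    {v : Space d} (hv : v ∈ vertices K) {x : Space d} (hx : x ∈ K) :
    GeometricDerivBound (weight K v) x
      (d.factorial * Metric.diam K ^ ((facets K).ncard - d)) (NF / Metric.diam K) := by
  rw [hK.weight_eq v]
  have h1 := GeometricDerivBound.prod (hK.finite_facets_sdiff v).toFinset
    (f := fun f => facetHeight K f) (x := x) (A := Metric.diam K) (a := (Metric.diam K)⁻¹)
    fun f hf => by
      have hf' := ((hK.finite_facets_sdiff v).mem_toFinset.mp hf).1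
      refine geometricDerivBound_inner_sub ?_ ?_ (by positivity)
      · exact (abs_of_nonneg (hK.facetHeight_nonneg hf' hx)).trans_le
          (hK.facetHeight_le_diam hf' hx)
      · rw [mul_inv_cancel₀ hH.ne', (hK.isUnitOutwardNormal hf').norm_eq_one]
  rw [hK.card_facets_sdiff hv] at h1
  refine ((GeometricDerivBound.const |(normalMatrix K v).det| x).mul h1).mono (by positivity) ?_ ?_
  · rw [abs_abs]
    exact mul_le_mul_of_nonneg_right (hK.abs_det_normalMatrix_le hv) (by positivity)
  · rw [zero_add, div_eq_mul_inv]
    have : (((facets K).ncard - d : ℕ) : ℝ) ≤ NF := by exact_mod_cast (Nat.sub_le _ _).trans hNF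
    gcongr

/-- A point of `K` is a convex combination of the vertices, one of which has a coefficient of at
least `1 / |V|`. The weight of that vertex is bounded below. -/
theorem le_totalWeight (hH : 0 < Metric.diam K) {NF NV : ℕ} (hNF : (facets K).ncard ≤ NF)
    (hNV : (vertices K).ncard ≤ NV) {c : ℝ} (hc : 0 < c) (hcK : c * Metric.diam K ≤ hStar K)
    {x : Space d} (hx : x ∈ K) :
    c ^ d / d.factorial * min 1 (c / (NV + 1)) ^ NF * Metric.diam K ^ ((facets K).ncard - d) ≤
      totalWeight K x := by
  set H := Metric.diam K
  obtain ⟨w, hw0, hw1, hw⟩ := hK.exists_convexCombination hx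
  have hVK : ∀ u ∈ hK.finite_vertices.toFinset, u ∈ K := fun u hu => by
    have hu' : IsExposed ℝ K {u} := hK.finite_vertices.mem_toFinset.mp hu
    exact hu'.subset rfl
  obtain ⟨u, hu, hwu⟩ : ∃ u ∈ hK.finite_vertices.toFinset, 1 / ((NV : ℝ) + 1) ≤ w u := by
    by_contra! hcon
    have h1 := Finset.sum_le_card_nsmul _ _ _ fun u hu => (hcon u hu).le
    have h2 : (hK.finite_vertices.toFinset.card : ℝ) ≤ NV := by
      rw [← ncard_eq_toFinset_card _ hK.finite_vertices]
      exact_mod_cast hNV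
    rw [hw1, nsmul_eq_mul, mul_one_div, le_div_iff₀ (by positivity)] at h1
    linarith
  have hu' := hK.finite_vertices.mem_toFinset.mp hu
  have hprod : (c / (NV + 1) * H) ^ ((facets K).ncard - d) ≤
      ∏ f ∈ (hK.finite_facets_sdiff u).toFinset, facetHeight K f x := by
    rw [← hK.card_facets_sdiff hu', ← Finset.prod_const]
    refine Finset.prod_le_prod (fun _ _ => by positivity) fun f hf => ?_
    obtain ⟨hf, hfu⟩ := (hK.finite_facets_sdiff u).mem_toFinset.mp hf
    calc c / (NV + 1) * H = 1 / ((NV : ℝ) + 1) * (c * H) := by ring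
      _ ≤ w u * facetHeight K f u := by
        refine mul_le_mul hwu (hcK.trans (hK.hStar_le_facetHeight hf hu' fun h => hfu ⟨hf, h⟩))
          (by positivity) (hw0 u hu)
      _ ≤ ∑ v ∈ hK.finite_vertices.toFinset, w v * facetHeight K f v :=
        Finset.single_le_sum (f := fun v => w v * facetHeight K f v) (fun v hv =>
          mul_nonneg (hw0 v hv) (hK.facetHeight_nonneg hf (hVK v hv))) hu
      _ = facetHeight K f x := by rw [← facetHeight_sum _ _ hw1, hw]
  have hdet : c ^ d / d.factorial ≤ |(normalMatrix K u).det| := by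
    have h1 : (c * H) ^ d ≤ |(normalMatrix K u).det| * (d.factorial * H ^ d) :=
      (pow_le_pow_left₀ (by positivity) hcK d).trans
        (hK.hStar_pow_le_abs_det hu' ((by positivity : 0 ≤ c * H).trans hcK))
    rw [mul_pow, ← mul_assoc] at h1
    rw [div_le_iff₀ (by positivity)]
    exact le_of_mul_le_mul_right h1 (by positivity)
  have hmin : min 1 (c / ((NV : ℝ) + 1)) ^ NF ≤ (c / (NV + 1)) ^ ((facets K).ncard - d) :=
    (pow_le_pow_of_le_one (by positivity) (min_le_left _ _) ((Nat.sub_le _ _).trans hNF)).trans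
      (pow_le_pow_left₀ (by positivity) (min_le_right _ _) _)
  calc _ = c ^ d / d.factorial *
        (min 1 (c / (NV + 1)) ^ NF * H ^ ((facets K).ncard - d)) := by ring
    _ ≤ |(normalMatrix K u).det| *
        ∏ f ∈ (hK.finite_facets_sdiff u).toFinset, facetHeight K f x := by
      refine mul_le_mul hdet (le_trans ?_ hprod) (by positivity) (abs_nonneg _)
      rw [mul_pow]
      gcongr
    _ = weight K u x := by rw [hK.weight_eq u]
    _ ≤ ∑ v ∈ hK.finite_vertices.toFinset, weight K v x :=
      Finset.single_le_sum (f := fun v => weight K v x) (fun v _ => hK.weight_nonneg v hx) hu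
    _ = totalWeight K x := by rw [hK.totalWeight_eq]

theorem vertices_nonempty {x : Space d} (hx : x ∈ K) : (vertices K).Nonempty := by
  obtain ⟨w, -, hw1, -⟩ := hK.exists_convexCombination hx
  obtain ⟨v, hv, -⟩ := Finset.exists_ne_zero_of_sum_ne_zero (hw1.trans_ne one_ne_zero)
  exact ⟨v, hK.finite_vertices.mem_toFinset.mp hv⟩

end IsSimplePolytope

end Wachspress

/-! ### Derivatives of the Wachspress coordinates -/

open Wachspress

theorem mainTheorem2 (d : ℕ) (hd : 1 ≤ d) (α : Fin d → ℕ) (NF NV : ℕ) (c : ℝ) (hc : 0 < c) :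
    ∃ C : ℝ, 0 < C ∧ ∀ K : Set (EuclideanSpace ℝ (Fin d)), Wachspress.IsSimplePolytope K →
      (Wachspress.facets K).ncard ≤ NF → (Wachspress.vertices K).ncard ≤ NV →
      c * Metric.diam K ≤ Wachspress.hStar K →
      ∀ x ∈ K, 0 < Wachspress.totalWeight K x ∧
        ∀ v ∈ Wachspress.vertices K,
          ContDiffAt ℝ ∞ (Wachspress.coord K v) x ∧
          |Wachspress.multiDeriv α (Wachspress.coord K v) x| ≤
            C * Metric.diam K ^ (-(∑ i, (α i : ℤ))) := by
  set n := ∑ i, α i with hn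
  set δ : ℝ := c ^ d / d.factorial * min 1 (c / (NV + 1)) ^ NF with hδ
  have hδ0 : 0 < δ := by positivity
  set Q := quotientBound d.factorial (NV * d.factorial) δ n
  refine ⟨|Q| * NF ^ n + 1, by positivity, fun K hK hNF hNV hcK x hx => ?_⟩
  obtain ⟨v₀, hv₀⟩ := hK.vertices_nonempty hx
  have hH := hK.diam_pos hd hv₀
  set H := Metric.diam K with hHdef
  set m := (facets K).ncard - d with hm
  have hWδ : δ * H ^ m ≤ totalWeight K x := hK.le_totalWeight hH hNF hNV hc hcK hx
  have hW : 0 < totalWeight K x := lt_of_lt_of_le (by positivity) hWδ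
  refine ⟨hW, fun v hv => ?_⟩
  have hwb := fun u (hu : u ∈ vertices K) => hK.geometricDerivBound_weight hH hNF hu hx
  have hWb : GeometricDerivBound (totalWeight K) x (NV * (d.factorial * H ^ m)) (NF / H) := by
    rw [hK.totalWeight_eq]
    refine (GeometricDerivBound.sum hK.finite_vertices.toFinset (f := weight K) fun u hu =>
      hwb u (hK.finite_vertices.mem_toFinset.mp hu)).mono (by positivity) ?_ le_rfl
    rw [← Set.ncard_eq_toFinset_card _ hK.finite_vertices]
    gcongr
  -- all weights are homogeneous of degree `m` in the length scale; this factor is removed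
  have hscale : ∀ {g : Space d → ℝ} {A : ℝ}, GeometricDerivBound g x (A * H ^ m) (NF / H) →
      GeometricDerivBound (fun y => (H ^ m)⁻¹ * g y) x A (NF / H) := fun {g A} hg => by
    refine ((GeometricDerivBound.const (H ^ m)⁻¹ x).mul hg).mono (by positivity) ?_ ?_
    · rw [abs_of_pos (by positivity), mul_comm A, inv_mul_cancel_left₀ (by positivity)]
    · rw [zero_add]
  have hcoord : coord K v =
      fun y => ((H ^ m)⁻¹ * weight K v y) / ((H ^ m)⁻¹ * totalWeight K y) := by
    funext y
    rw [coord, mul_div_mul_left _ _ (by positivity)]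
  have hQ : ‖iteratedFDeriv ℝ n (coord K v) x‖ ≤ Q * (NF / H) ^ n := by
    rw [hcoord]
    refine (hscale (hwb v hv)).norm_iteratedFDeriv_div_le (hscale (by rwa [mul_assoc]))
      (by positivity) hδ0 ?_ n
    rwa [inv_mul_eq_div, le_div_iff₀ (by positivity)]
  have hU : IsOpen {y | totalWeight K y ≠ 0} := isOpen_ne_fun hWb.1.continuous continuous_const
  have hsm : ContDiffOn ℝ ∞ (coord K v) {y | totalWeight K y ≠ 0} :=
    (hwb v hv).1.contDiffOn.div hWb.1.contDiffOn fun y hy => hy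
  have hxU : x ∈ {y | totalWeight K y ≠ 0} := hW.ne'
  refine ⟨hsm.contDiffAt (hU.mem_nhds hxU), ?_⟩
  have hz : H ^ (-(∑ i, (α i : ℤ))) = (H ^ n)⁻¹ := by
    rw [zpow_neg, ← Nat.cast_sum, zpow_natCast]
  rw [hz]
  calc |multiDeriv α (coord K v) x| ≤ Q * (NF / H) ^ n := (abs_multiDeriv_le hU hsm α hxU).trans hQ
    _ ≤ |Q| * (NF / H) ^ n := by gcongr; exact le_abs_self Q
    _ = |Q| * NF ^ n * (H ^ n)⁻¹ := by rw [div_pow]; ring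
    _ ≤ (|Q| * NF ^ n + 1) * (H ^ n)⁻¹ := by gcongr; linarith
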